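/- A derivator is a nondecreasing left-continuous function $g:\mathbb R\to\mathbb R$. Put $D_g=\{t: g(t^+)>g(t)\}$, let $C_g$ be the open set of points around which $g$ is constant, with connected components $(a_n,b_n)$, and let $\mu_g$ be the Lebesgue–Stieltjes measure with $\mu_g([a,b))=g(b)-g(a)$. The $g$-derivative at $t$ of a function $f$ on an interval $I$ is $$\lim_{s\to t}\frac{f(s)-f(t)}{g(s)-g(t)}\ \ (t\notin D_g\cup C_g),\qquad \lim_{s\to t^+}\frac{f(s)-f(t)}{g(s)-g(t)}\ \ (t\in D_g),\qquad \lim_{s\to b_n^+}\frac{f(s)-f(b_n)}{g(s)-g(b_n)}\ \ (t\in(a_n,b_n)),$$ the limits being taken over the $s\in I$ where the quotient is defined, which must accumulate at the limit point. For $G:\mathbb R^2\to\mathbb R$ such that all $G(\cdot,x)$ and $G(t,\cdot)$ are derivators, $\partial u/\partial_Gt$ is the derivative of $u(\cdot,x)$ with respect to $G(\cdot,x)$, and $\partial u/\partial_Gx$ that of $u(t,\cdot)$ with respect to $G(t,\cdot)$. Let $g,h$ be derivators with $g(0)=h(0)=0$, let $G(t,x)=g(t)+h(x)$, and let $c,T,L>0$.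 Assume $T\notin D_g\cup C_g$, $L\notin D_h\cup C_h$ and, so that the above limits make sense at all points of $[0,T]$ and $[0,L]$, that $T$ (resp. $L$) is not the right endpoint of a connected component of $C_g$ (resp. $C_h$), and that $0$ is not the left endpoint of a component of $C_g$ unless $0\in D_g$, nor of a component of $C_h$ unless $0\in D_h$. Define the $g$-monomials by $g_0=1$, $g_n(t)=n\int_0^t g_{n-1}\,d\mu_g$ (where $\int_0^t$ is the integral over $[0,t)$ if $t\ge 0$, and minus the integral over $[t,0)$ if $t<0$), define $h_n$ likewise from $h$, and define the heat $G$-polynomials by $$v_n^G(t,x)=\sum_{k=0}^{\lfloor n/2\rfloor}\frac{n!\,c^{2k}}{(n-2k)!\,k!}\,g_k(t)\,h_{n-2k}(x).$$ Let $(\alpha_n)_{n\ge0}$ be a sequence in $\mathbb F\in\{\mathbb R,\mathbb C\}$, and let $\sigma\in[0,\infty]$ be given by $\frac1\sigma=\limsup_{n\to\infty}\frac{2n|\alpha_n|^{2/n}}{e}$ (with $1/0=\infty$ and $1/\infty=0$). **Theorem.** If $g(T)<\sigma/c^2$, then the series $u=\sum_{n=0}^\infty\alpha_nv_n^G$ converges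 absolutely and uniformly on $[0,T]\times[0,L]$. Moreover, $u$ and the terms $\alpha_n v_n^G$ have $G$-derivatives of all orders, mixed ones included and in every order of differentiation, at all points of $[0,T]\times[0,L]$, and for each such derivative the series of the derivatives of the terms converges absolutely and uniformly on $[0,T]\times[0,L]$ to the derivative of $u$. In particular, $u$ is a solution of $$\frac{\partial u}{\partial_Gt}(t,x)-c^2\frac{\partial^2u}{\partial_Gx^2}(t,x)=0\qquad\text{for all }(t,x)\in[0,T]\times[0,L].$$ -/

import Mathlib

open Set Filter Topology MeasureTheory
open scoped ENNReal Nat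

noncomputable section

namespace StieltjesHeat

/-- A derivator: a nondecreasing left-continuous function on the real line. -/
structure Derivator where
  toFun : ℝ → ℝ
  mono : Monotone toFun
  left_cont : ∀ t, ContinuousWithinAt toFun (Iic t) t

instance : CoeFun Derivator (fun _ => ℝ → ℝ) := ⟨Derivator.toFun⟩

/-- The set `D_g` of jump points of `g`, that is, the points with `g(t⁺) - g(t) > 0`. -/
def jumpSet (g : ℝ → ℝ) : Set ℝ := {t | 0 < Function.rightLim g t - g t}

/-- The set `C_g` of the points around which `g` is constant. -/
def constSet (g : ℝ → ℝ) : Set ℝ :=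
  {t | ∃ ε > 0, ∀ s ∈ Ioo (t - ε) (t + ε), g s = g t}

/-- The left endpoints `aₙ` of the connected components `(aₙ, bₙ)` of `C_g`. -/
def constLeftEnds (g : ℝ → ℝ) : Set ℝ :=
  {a | ∃ t ∈ constSet g, IsGLB (connectedComponentIn (constSet g) t) a}

/-- The right endpoints `bₙ` of the connected components `(aₙ, bₙ)` of `C_g`. -/
def constRightEnds (g : ℝ → ℝ) : Set ℝ :=
  {b | ∃ t ∈ constSet g, IsLUB (connectedComponentIn (constSet g) t) b}

/-- `b` is the point `t*`: it is `t` itself if `t ∉ C_g`, and the right endpoint of the connected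
component of `C_g` that contains `t` if `t ∈ C_g`. -/
def IsStarPoint (g : ℝ → ℝ) (t b : ℝ) : Prop :=
  (t ∉ constSet g ∧ b = t) ∨
    (t ∈ constSet g ∧ IsLUB (connectedComponentIn (constSet g) t) b)

section Derivative

variable {E : Type*} [NormedAddCommGroup E] [NormedSpace ℝ E]

/-- The quotient `(f s - f b) / (g s - g b)` tends to `d` as `s → b`, where `s` runs through the
points of `S` at which the quotient is defined; such points must accumulate at `b`. -/
def HasQuotientLimit (g : ℝ → ℝ) (S : Set ℝ) (f : ℝ → E) (d : E) (b : ℝ) : Prop :=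
  (𝓝[{s ∈ S | g s ≠ g b}] b).NeBot ∧
    Tendsto (fun s => (g s - g b)⁻¹ • (f s - f b)) (𝓝[{s ∈ S | g s ≠ g b}] b) (𝓝 d)

/-- The Stieltjes derivative with respect to `g`, at the point `t`, of a function `f` with
domain `I` exists and equals `d`. Only the values of `f` on the interval `I` matter. -/
def HasStieltjesDeriv (g : ℝ → ℝ) (I : Set ℝ) (f : ℝ → E) (d : E) (t : ℝ) : Prop :=
  (t ∉ jumpSet g ∪ constSet g ∧ HasQuotientLimit g I f d t) ∨
    (t ∈ jumpSet g ∪ constSet g ∧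
      ∃ b, IsStarPoint g t b ∧ HasQuotientLimit g (I ∩ Ioi b) f d b)

end Derivative

/-- The Lebesgue-Stieltjes measure `μ_g`, see `Derivator.measure_Ico`. -/
def Derivator.measure (g : Derivator) : Measure ℝ := g.mono.stieltjesFunction.measure

theorem Derivator.measure_Ico (g : Derivator) (a b : ℝ) :
    g.measure (Ico a b) = ENNReal.ofReal (g b - g a) := by
  have key : ∀ x, Function.leftLim g.mono.stieltjesFunction x = g x := by
    intro x
    have h1 : Tendsto g (𝓝[<] x) (𝓝 (g x)) :=
      (g.left_cont x).tendsto.mono_left (nhdsWithin_mono _ Iio_subset_Iic_self)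
    have h2 : Function.leftLim g.toFun x = g x := leftLim_eq_of_tendsto h1
    apply le_antisymm
    · refine le_of_tendsto (g.mono.stieltjesFunction.mono.tendsto_leftLim x) ?_
      filter_upwards [self_mem_nhdsWithin] with y hy
      rw [Monotone.stieltjesFunction_eq]
      exact g.mono.rightLim_le hy
    · rw [← h2]
      refine le_of_tendsto_of_tendsto (g.mono.tendsto_leftLim x)
        (g.mono.stieltjesFunction.mono.tendsto_leftLim x) ?_
      filter_upwards with y
      rw [Monotone.stieltjesFunction_eq]
      exact g.mono.le_rightLim le_rfl
  rw [Derivator.measure, StieltjesFunction.measure_Ico, key, key]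

/-- The oriented integral: over `[a, b)` if `a ≤ b`, and minus the integral over `[b, a)` if
`b < a`. -/
def Derivator.integral (g : Derivator) (f : ℝ → ℝ) (a b : ℝ) : ℝ :=
  if a ≤ b then ∫ s in Ico a b, f s ∂g.measure else -∫ s in Ico b a, f s ∂g.measure

/-- The `g`-monomials `g_{x₀,n}` centered at `x₀`. -/
def Derivator.monomial (g : Derivator) (x₀ : ℝ) : ℕ → ℝ → ℝ
  | 0 => fun _ => 1
  | n + 1 => fun x => (n + 1 : ℝ) * g.integral (g.monomial x₀ n) x₀ x

/-- A derivator of two variables: each section is nondecreasing and left-continuous. -/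
structure Derivator₂ where
  toFun : ℝ → ℝ → ℝ
  mono_left : ∀ x, Monotone fun t => toFun t x
  left_cont_left : ∀ x t, ContinuousWithinAt (fun s => toFun s x) (Iic t) t
  mono_right : ∀ t, Monotone fun x => toFun t x
  left_cont_right : ∀ t x, ContinuousWithinAt (fun y => toFun t y) (Iic x) x

instance : CoeFun Derivator₂ (fun _ => ℝ → ℝ → ℝ) := ⟨Derivator₂.toFun⟩

/-- The derivator of two variables `G(t, x) = g(t) + h(x)`. -/
def Derivator.sum (g h : Derivator) : Derivator₂ where
  toFun t x := g t + h x
  mono_left x := g.mono.add_const (h x)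
  left_cont_left _ t := (g.left_cont t).add continuousWithinAt_const
  mono_right t := h.mono.const_add (g t)
  left_cont_right _ x := continuousWithinAt_const.add (h.left_cont x)

/-- The two variables, time and space. -/
inductive Var
  | time
  | space

section Derivative₂

variable {E : Type*} [NormedAddCommGroup E] [NormedSpace ℝ E]

/-- On `I × J` the function `u` has a `G`-derivative with respect to the given variable at every
point, and this derivative is `u'`. -/
def HasPartial (G : Derivator₂) (I J : Set ℝ) : Var → (ℝ → ℝ → E) → (ℝ → ℝ → E) → Prop
  | .time, u, u' => ∀ t ∈ I, ∀ x ∈ J,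
      HasStieltjesDeriv (fun s => G s x) I (fun s => u s x) (u' t x) t
  | .space, u, u' => ∀ t ∈ I, ∀ x ∈ J,
      HasStieltjesDeriv (fun y => G t y) J (fun y => u t y) (u' t x) x

/-- `v` is the iterated (possibly mixed) `G`-derivative of `u` on `I × J`; the list holds the
variables of differentiation, the last one applied at its head. -/
def HasIteratedPartial (G : Derivator₂) (I J : Set ℝ) :
    List Var → (ℝ → ℝ → E) → (ℝ → ℝ → E) → Prop
  | [], u, v => ∀ t ∈ I, ∀ x ∈ J, v t x = u t x
  | i :: w, u, v => ∃ u', HasIteratedPartial G I J w u u' ∧ HasPartial G I J i u' v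

/-- `u` solves the heat equation `∂u/∂_G t - c² ∂²u/∂_G x² = 0` at every point of `I × J`; the
derivatives in the equation are required to exist. -/
def IsHeatSolution (G : Derivator₂) (c : ℝ) (I J : Set ℝ) (u : ℝ → ℝ → E) : Prop :=
  ∃ ut uxx : ℝ → ℝ → E, HasIteratedPartial G I J [.time] u ut ∧
    HasIteratedPartial G I J [.space, .space] u uxx ∧
    ∀ t ∈ I, ∀ x ∈ J, ut t x - (c ^ 2) • uxx t x = 0

end Derivative₂

/-- The heat `G`-polynomial of degree `n` for `G(t, x) = g(t) + h(x)`. -/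
def heatPoly (c : ℝ) (g h : Derivator) (n : ℕ) (t x : ℝ) : ℝ :=
  ∑ k ∈ Finset.range (n / 2 + 1),
    ((n ! : ℝ) * c ^ (2 * k)) / (((n - 2 * k)! : ℝ) * (k ! : ℝ)) *
      g.monomial 0 k t * h.monomial 0 (n - 2 * k) x

/-- The number `σ ∈ [0, ∞]` with `1 / σ = lim sup 2 n |αₙ|^(2/n) / e`. -/
def sigma {𝔽 : Type*} [RCLike 𝔽] (α : ℕ → 𝔽) : ℝ≥0∞ :=
  (limsup (fun n : ℕ =>
    ENNReal.ofReal (2 * (n : ℝ) * ‖α n‖ ^ ((2 : ℝ) / (n : ℝ)) / Real.exp 1)) atTop)⁻¹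

end StieltjesHeat

end

open StieltjesHeat

namespace StieltjesHeat

/-! ### Level sets of a derivator, and a criterion for Stieltjes differentiability. -/

section Geometry

variable (g : Derivator)

/-! The monomials play the role of powers: the `g`-derivative of `g_k` is `k g_{k-1}`. On the
coefficients this gives `∂_t v_n = c² n(n-1) v_{n-2}` and `∂_x v_n = n v_{n-1}`
(`heatSum_shift_left`, `heatSum_shift_right`). Hence every iterated derivative of `αₙ vₙ` is `αₙ
c^(2a) n(n-1)⋯(n-m+1) v_{n-m}`, where `a` counts the time derivatives and `m` is the total order
with time counted twice. The order of differentiation is irrelevant, and the heat equation compares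
`(a, m) = (1, 2)` with `(0, 2)`.

For convergence, `g_n ≤ g^n` on `[0, ∞)` (`monomial_le_pow`, a Fubini argument) reduces all
estimates to classical heat polynomials with `g(T)` and `h(L)` as arguments. Their generating
function bounds `v_n` by `n! exp(c² g(T) r² + h(L) r) / r^n` for every `r > 0`. Taking `r` of order
`√n`, with Stirling's bound and the definition of `σ`, yields geometric decay that absorbs any power
of `n` (`summable_termBound`).

Termwise differentiation rests on a quantitative first-order expansion in `g`, whose remainder is
controlled by the bound for two more derivatives in the same variable. These bounds are summable, so
the series inherits the expansion, and `hasStieltjesDeriv_of_bound` turns it into a derivative at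
continuity points, jumps and points of constancy alike. -/

theorem rightLim_add_const (C t : ℝ) :
    Function.rightLim (fun s => g s + C) t = Function.rightLim g t + C :=
  rightLim_eq_of_tendsto ((g.mono.tendsto_rightLim t).add_const C)

theorem jumpSet_add_const (C : ℝ) : jumpSet (fun s => g s + C) = jumpSet g := by
  ext t
  simp only [jumpSet, Set.mem_ofPred_eq, rightLim_add_const, add_sub_add_right_eq_sub]

theorem constSet_add_const (g : ℝ → ℝ) (C : ℝ) : constSet (fun s => g s + C) = constSet g := by
  ext t
  simp only [constSet, Set.mem_ofPred_eq, add_left_inj]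

/-- Only differences of `g` enter the derivative, so a partial derivative for `G = g + h` is an
ordinary derivative with respect to `g` or `h`. -/
theorem hasStieltjesDeriv_add_const {E : Type*} [NormedAddCommGroup E] [NormedSpace ℝ E]
    {I : Set ℝ} {f : ℝ → E} {d : E} {t : ℝ} (C : ℝ) (H : HasStieltjesDeriv g I f d t) :
    HasStieltjesDeriv (fun s => g s + C) I f d t := by
  simpa only [HasStieltjesDeriv, IsStarPoint, HasQuotientLimit, jumpSet_add_const,
    constSet_add_const, add_left_inj, add_sub_add_right_eq_sub, ne_eq] using H

variable {g}

theorem mem_constSet_of_eq {a b t : ℝ} (hat : a < t) (htb : t < b) (hab : g a = g b) :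
    t ∈ constSet g := by
  refine ⟨min (t - a) (b - t), lt_min (sub_pos.2 hat) (sub_pos.2 htb), fun s hs => ?_⟩
  have h1 : a < s := by linarith [hs.1, min_le_left (t - a) (b - t)]
  have h2 : s < b := by linarith [hs.2, min_le_right (t - a) (b - t)]
  linarith [g.mono h1.le, g.mono h2.le, g.mono hat.le, g.mono htb.le]

theorem exists_eq_of_mem_constSet {t : ℝ} (ht : t ∈ constSet g) :
    ∃ a < t, ∃ b > t, g a = g t ∧ g b = g t := by
  obtain ⟨ε, hε, H⟩ := ht
  exact ⟨t - ε / 2, by linarith, t + ε / 2, by linarith,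
    H _ ⟨by linarith, by linarith⟩, H _ ⟨by linarith, by linarith⟩⟩

theorem lt_of_mem_jumpSet {t s : ℝ} (ht : t ∈ jumpSet g) (hs : t < s) : g t < g s := by
  have := g.mono.rightLim_le hs
  have h2 : 0 < Function.rightLim g t - g t := ht
  linarith

theorem rightLim_eq_of_not_mem_jumpSet {t : ℝ} (ht : t ∉ jumpSet g) :
    Function.rightLim g t = g t := by
  have h1 : ¬ 0 < Function.rightLim g t - g t := ht
  have h2 : g t ≤ Function.rightLim g t := g.mono.le_rightLim le_rfl
  linarith

theorem not_mem_constSet_of_mem_jumpSet {t : ℝ} (ht : t ∈ jumpSet g) : t ∉ constSet g := by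
  intro h
  obtain ⟨-, -, b, hb, -, h2⟩ := exists_eq_of_mem_constSet h
  exact (lt_of_mem_jumpSet ht hb).ne' h2

/-- The right endpoint of the component of a point of `C_g` to the left of a point outside `C_g`
that is not itself a right endpoint. -/
theorem exists_isLUB_component {t T : ℝ} (ht : t ∈ constSet g) (htT : t ≤ T)
    (hT : T ∉ constSet g) (hT' : T ∉ constRightEnds g) :
    ∃ b, t ≤ b ∧ b < T ∧ g b = g t ∧ IsLUB (connectedComponentIn (constSet g) t) b ∧
      ∀ s, b < s → g b < g s := by
  obtain ⟨a, ha, -, -, hat, -⟩ := exists_eq_of_mem_constSet ht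
  -- A point of the level set of `t` beyond `T` would make `g` constant around `T`.
  have hub : ∀ s, g s = g t → s ≤ T := by
    intro s hs
    by_contra! h
    exact hT (mem_constSet_of_eq (ha.trans_le htT) h (hat.trans hs.symm))
  -- The endpoint sought is the supremum of the level set; left continuity of `g` puts it in the
  -- level set.
  set S : Set ℝ := {s | g s = g t} with hS
  have hbdd : BddAbove S := ⟨T, fun s hs => hub s hs⟩
  have htS : t ∈ S := rfl
  set b := sSup S with hb
  have htb : t ≤ b := le_csSup hbdd htS
  have hlt : ∀ s, t ≤ s → s < b → g s = g t := by
    intro s hts hsb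
    obtain ⟨r, hr, hsr⟩ := exists_lt_of_lt_csSup ⟨t, htS⟩ hsb
    exact le_antisymm ((g.mono hsr.le).trans_eq hr) (g.mono hts)
  have hgb : g b = g t := by
    rcases htb.eq_or_lt with h | h
    · rw [← h]
    · refine le_antisymm ?_ (g.mono htb)
      refine le_of_tendsto ((g.left_cont b).tendsto.mono_left
        (nhdsWithin_mono _ Iio_subset_Iic_self)) ?_
      filter_upwards [Ioo_mem_nhdsLT h] with s hs
      exact (hlt s hs.1.le hs.2).le
  have hgt : ∀ s, b < s → g b < g s := by
    intro s hs
    refine lt_of_le_of_ne (g.mono hs.le) fun h => ?_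
    exact hs.not_ge (le_csSup hbdd (h.symm.trans hgb))
  have hbC : b ∉ constSet g := by
    intro h
    obtain ⟨-, -, s, hs, -, h2⟩ := exists_eq_of_mem_constSet h
    exact (hgt s hs).ne' h2
  have hLUB : IsLUB (connectedComponentIn (constSet g) t) b := by
    have htb' : t < b := lt_of_le_of_ne htb (by rintro h; exact hbC (h ▸ ht))
    constructor
    · intro k hk
      by_contra! hkb
      have := isPreconnected_connectedComponentIn.ordConnected.out
        (mem_connectedComponentIn ht) hk ⟨htb, hkb.le⟩
      exact hbC (connectedComponentIn_subset _ _ this)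
    · intro x hx
      have hsub : Ico t b ⊆ connectedComponentIn (constSet g) t := by
        refine isPreconnected_Ico.subset_connectedComponentIn ⟨le_rfl, htb'⟩ fun s hs => ?_
        exact mem_constSet_of_eq (ha.trans_le hs.1) hs.2 (hat.trans hgb.symm)
      refine le_of_forall_lt fun y hy => ?_
      obtain ⟨z, hz1, hz2⟩ := exists_between (max_lt hy htb')
      exact ((le_max_left _ _).trans_lt hz1).trans_le
        (hx (hsub ⟨(le_max_right _ _).trans hz1.le, hz2⟩))
  refine ⟨b, htb, lt_of_le_of_ne (hub b hgb) ?_, hgb, hLUB, hgt⟩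
  intro h
  exact hT' ⟨t, ht, h ▸ hLUB⟩

/-- With equality, a point between `s` and `T` would lie in a component ending before `T`, and `g`
exceeds its value there strictly beyond that end. -/
theorem lt_of_not_mem_constRightEnds {s T : ℝ} (hT : T ∉ constSet g)
    (hT' : T ∉ constRightEnds g) (hs : s < T) : g s < g T := by
  refine lt_of_le_of_ne (g.mono hs.le) fun h => ?_
  obtain ⟨p, hp1, hp2⟩ := exists_between hs
  obtain ⟨b, hpb, hbT, hgb, -, hgt⟩ :=
    exists_isLUB_component (mem_constSet_of_eq hp1 hp2 h) hp2.le hT hT'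
  have := hgt T hbT
  linarith [g.mono (hp1.le.trans hpb)]

theorem lt_of_not_mem_constLeftEnds {s a : ℝ} (ha : a ∉ constSet g)
    (ha' : a ∉ constLeftEnds g) (hs : a < s) : g a < g s := by
  refine lt_of_le_of_ne (g.mono hs.le) fun h => ha' ?_
  have hsub : Ioo a s ⊆ constSet g := fun r hr => mem_constSet_of_eq hr.1 hr.2 h
  obtain ⟨p, hp⟩ := nonempty_Ioo.2 hs
  refine ⟨p, hsub hp, fun k hk => ?_, fun x hx => ?_⟩
  · by_contra! hka
    exact ha (connectedComponentIn_subset _ _ (isPreconnected_connectedComponentIn.ordConnected.out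
      hk (mem_connectedComponentIn (hsub hp)) ⟨hka.le, hp.1.le⟩))
  · have hsub' := isPreconnected_Ioo.subset_connectedComponentIn hp hsub
    refine le_of_forall_gt fun y hy => ?_
    obtain ⟨z, hz1, hz2⟩ := exists_between (lt_min hy hs)
    exact (hx (hsub' ⟨hz1, hz2.trans_le (min_le_right _ _)⟩)).trans_lt
      (hz2.trans_le (min_le_left _ _))

theorem nhdsWithin_right_neBot {b T : ℝ} {S : Set ℝ} (hbT : b < T) (hS : Ioo b T ⊆ S)
    (h : ∀ s, b < s → g b < g s) : (𝓝[{s ∈ S | g s ≠ g b}] b).NeBot := by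
  have : (𝓝[>] b).NeBot := inferInstance
  refine this.mono (nhdsWithin_le_of_mem ?_)
  filter_upwards [Ioo_mem_nhdsGT hbT] with s hs
  exact ⟨hS hs, (h s hs.1).ne'⟩

theorem nhdsWithin_left_neBot {a b : ℝ} {S : Set ℝ} (hab : a < b) (hS : Ioo a b ⊆ S)
    (h : ∀ s, s < b → g s < g b) : (𝓝[{s ∈ S | g s ≠ g b}] b).NeBot := by
  have : (𝓝[<] b).NeBot := inferInstance
  refine this.mono (nhdsWithin_le_of_mem ?_)
  filter_upwards [Ioo_mem_nhdsLT hab] with s hs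
  exact ⟨hS hs, (h s hs.2).ne⟩

theorem continuousAt_of_not_mem_jumpSet {t : ℝ} (ht : t ∉ jumpSet g) : ContinuousAt g t := by
  rw [continuousAt_iff_continuous_left'_right']
  refine ⟨(g.left_cont t).mono Iio_subset_Iic_self, ?_⟩
  have := g.mono.tendsto_rightLim t
  rwa [rightLim_eq_of_not_mem_jumpSet ht] at this

section Bound

variable {E : Type*} [NormedAddCommGroup E] [NormedSpace ℝ E]

theorem norm_quotient_sub_le {f : ℝ → E} {d : E} {b s e K : ℝ} (hne : g s ≠ g b)
    (H : ‖f s - f b - (g s - g b) • d‖ ≤ K * |g s - g b| * e) :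
    ‖(g s - g b)⁻¹ • (f s - f b) - d‖ ≤ K * e := by
  have h0 : g s - g b ≠ 0 := sub_ne_zero.2 hne
  have h1 : (g s - g b)⁻¹ • (f s - f b) - d
      = (g s - g b)⁻¹ • (f s - f b - (g s - g b) • d) := by
    rw [smul_sub _ (f s - f b), smul_smul, inv_mul_cancel₀ h0, one_smul]
  rw [h1, norm_smul, norm_inv, Real.norm_eq_abs, inv_mul_le_iff₀ (abs_pos.2 h0)]
  linarith

/-- A function with a first-order Taylor expansion in `g` with locally controlled remainder has
Stieltjes derivatives everywhere on `[0, T]`. -/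
theorem hasStieltjesDeriv_of_bound {T : ℝ} (hT : 0 < T) (hgT : T ∉ jumpSet g ∪ constSet g)
    (hgT' : T ∉ constRightEnds g) (hg0 : 0 ∉ constLeftEnds g \ jumpSet g)
    {f f' : ℝ → E} {K : ℝ}
    (hconst : ∀ s ∈ Icc 0 T, ∀ t ∈ Icc 0 T, g s = g t → f' s = f' t)
    (hR : ∀ b ∈ Icc 0 T, ∀ s ∈ Icc 0 T, b < s →
      ‖f s - f b - (g s - g b) • f' b‖ ≤ K * |g s - g b| * (g s - Function.rightLim g b))
    (hL : ∀ b ∈ Icc 0 T, ∀ s ∈ Icc 0 T, s < b →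
      ‖f s - f b - (g s - g b) • f' b‖ ≤ K * |g s - g b| * (g b - g s))
    {t : ℝ} (ht : t ∈ Icc 0 T) : HasStieltjesDeriv g (Icc 0 T) f (f' t) t := by
  simp only [mem_union, not_or] at hgT
  -- The remainder is measured from `g(b⁺)`, not from `g(b)`, so the error tends to `0` from the
  -- right even when `b` is a jump.
  have right : ∀ b, b ∈ Icc 0 T → b < T → (∀ s, b < s → g b < g s) →
      HasQuotientLimit g (Icc 0 T ∩ Ioi b) f (f' b) b := by
    intro b hb hbT hlt
    refine ⟨nhdsWithin_right_neBot hbT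
      (fun s hs => ⟨⟨hb.1.trans hs.1.le, hs.2.le⟩, hs.1⟩) hlt, ?_⟩
    rw [tendsto_iff_norm_sub_tendsto_zero]
    have hlim : Tendsto (fun s => K * (g s - Function.rightLim g b))
        (𝓝[{s ∈ Icc 0 T ∩ Ioi b | g s ≠ g b}] b) (𝓝 0) := by
      have h1 := ((g.mono.tendsto_rightLim b).sub_const (Function.rightLim g b)).const_mul K
      simp only [sub_self, mul_zero] at h1
      exact h1.mono_left (nhdsWithin_mono _ fun s hs => hs.1.2)
    refine squeeze_zero' (Eventually.of_forall fun _ => norm_nonneg _) ?_ hlim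
    filter_upwards [self_mem_nhdsWithin] with s hs
    exact norm_quotient_sub_le hs.2 (hR b hb s hs.1.1 hs.1.2)
  by_cases hD : t ∈ jumpSet g
  · refine Or.inr ⟨Or.inl hD, t, Or.inl ⟨not_mem_constSet_of_mem_jumpSet hD, rfl⟩, ?_⟩
    exact right t ht (lt_of_le_of_ne ht.2 fun h => hgT.1 (h ▸ hD))
      fun s hs => lt_of_mem_jumpSet hD hs
  by_cases hC : t ∈ constSet g
  · obtain ⟨b, htb, hbT, hgb, hLUB, hgt⟩ := exists_isLUB_component hC ht.2 hgT.2 hgT'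
    have hb : b ∈ Icc 0 T := ⟨ht.1.trans htb, hbT.le⟩
    refine Or.inr ⟨Or.inr hC, b, Or.inr ⟨hC, hLUB⟩, ?_⟩
    -- The derivative at `t` is by definition taken at the right endpoint `b`, where `g` has the
    -- same value.
    rw [hconst t ht b hb hgb.symm]
    exact right b hb hbT hgt
  refine Or.inl ⟨by simp [hD, hC], ?_, ?_⟩
  · have key : (t < T ∧ ∀ s, t < s → g t < g s) ∨ (0 < t ∧ ∀ s, s < t → g s < g t) := by
      rcases ht.2.eq_or_lt with rfl | htT
      · exact Or.inr ⟨hT, fun s hs => lt_of_not_mem_constRightEnds hC hgT' hs⟩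
      rcases ht.1.eq_or_lt with rfl | ht0
      · exact Or.inl ⟨hT, fun s hs =>
          lt_of_not_mem_constLeftEnds hC (fun h => hg0 ⟨h, hD⟩) hs⟩
      by_contra! hcon
      obtain ⟨⟨s, hs, hs'⟩, r, hr, hr'⟩ := And.intro (hcon.1 htT) (hcon.2 ht0)
      exact hC (mem_constSet_of_eq hr hs (by linarith [g.mono hs.le, g.mono hr.le]))
    rcases key with ⟨h1, h2⟩ | ⟨h1, h2⟩
    · exact nhdsWithin_right_neBot h1 (fun s hs => ⟨ht.1.trans hs.1.le, hs.2.le⟩) h2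
    · exact nhdsWithin_left_neBot h1 (fun s hs => ⟨hs.1.le, hs.2.le.trans ht.2⟩) h2
  · rw [tendsto_iff_norm_sub_tendsto_zero]
    have hlim : Tendsto (fun s => K * |g s - g t|)
        (𝓝[{s ∈ Icc 0 T | g s ≠ g t}] t) (𝓝 0) := by
      have h1 := (((continuousAt_of_not_mem_jumpSet hD).tendsto.sub_const (g t)).abs).const_mul K
      simp only [sub_self, abs_zero, mul_zero] at h1
      exact h1.mono_left nhdsWithin_le_nhds
    refine squeeze_zero' (Eventually.of_forall fun _ => norm_nonneg _) ?_ hlim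
    filter_upwards [self_mem_nhdsWithin] with s hs
    refine norm_quotient_sub_le hs.2 ?_
    rcases lt_trichotomy s t with h | rfl | h
    · rw [abs_of_nonpos (sub_nonpos.2 (g.mono h.le)), neg_sub]
      have := hL t ht s hs.1 h
      rwa [abs_of_nonpos (sub_nonpos.2 (g.mono h.le)), neg_sub] at this
    · exact absurd rfl hs.2
    · rw [abs_of_nonneg (sub_nonneg.2 (g.mono h.le))]
      have := hR t ht s hs.1 h
      rwa [abs_of_nonneg (sub_nonneg.2 (g.mono h.le)), rightLim_eq_of_not_mem_jumpSet hD] at this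

end Bound

end Geometry

/-! ### Monomials: growth, Lipschitz bounds and first-order expansion in `g`. -/

section Monomial

instance (g : Derivator) : IsLocallyFiniteMeasure g.measure :=
  inferInstanceAs (IsLocallyFiniteMeasure g.mono.stieltjesFunction.measure)

variable {g : Derivator}

theorem measureReal_Ico {a b : ℝ} (hab : a ≤ b) : g.measure.real (Ico a b) = g b - g a := by
  rw [measureReal_def, g.measure_Ico, ENNReal.toReal_ofReal (sub_nonneg.2 (g.mono hab))]

/-- Remove from `[a, b)` the atom at `a`, of mass `g(a⁺) - g(a)`. -/
theorem measureReal_Ioo {a b : ℝ} (hab : a < b) :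
    g.measure.real (Ioo a b) = g b - Function.rightLim g a := by
  have h1 : g.measure (Ico a b) = g.measure {a} + g.measure (Ioo a b) := by
    rw [← measure_union (by simp) measurableSet_Ioo, singleton_union, Ioo_insert_left hab]
  have h2 : g.measure.real (Ico a b) = g.measure.real {a} + g.measure.real (Ioo a b) := by
    rw [measureReal_def, h1, ENNReal.toReal_add isCompact_singleton.measure_lt_top.ne
      (measure_ne_top_of_subset Ioo_subset_Icc_self isCompact_Icc.measure_lt_top.ne)]
    rfl
  have h3 : g.measure.real {a} = Function.rightLim g a - g a := by
    have h4 : Tendsto g (𝓝[<] a) (𝓝 (g a)) :=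
      (g.left_cont a).tendsto.mono_left (nhdsWithin_mono _ Iio_subset_Iic_self)
    have h5 : g.measure (Icc a a) = ENNReal.ofReal (Function.rightLim g a - g a) := by
      have h6 : Function.leftLim g.mono.stieltjesFunction a = g a := by
        apply le_antisymm
        · refine le_of_tendsto (g.mono.stieltjesFunction.mono.tendsto_leftLim a) ?_
          filter_upwards [self_mem_nhdsWithin] with y hy
          rw [Monotone.stieltjesFunction_eq]
          exact g.mono.rightLim_le hy
        · refine le_of_tendsto_of_tendsto h4
            (g.mono.stieltjesFunction.mono.tendsto_leftLim a) ?_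
          filter_upwards with y
          rw [Monotone.stieltjesFunction_eq]
          exact g.mono.le_rightLim le_rfl
      rw [Derivator.measure, StieltjesFunction.measure_Icc, h6, Monotone.stieltjesFunction_eq]
    rw [measureReal_def, ← Icc_self, h5,
      ENNReal.toReal_ofReal (sub_nonneg.2 (g.mono.le_rightLim le_rfl))]
  rw [measureReal_Ico hab.le, h3] at h2
  linarith

theorem integrableOn_Ico_of_monotoneOn {f : ℝ → ℝ} (hf : MonotoneOn f (Ici 0)) {a b : ℝ}
    (ha : 0 ≤ a) : IntegrableOn f (Ico a b) g.measure := by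
  rcases le_or_gt b a with h | h
  · simp [Ico_eq_empty (not_lt.2 h)]
  · exact ((hf.mono (Icc_subset_Ici_self.trans (Ici_subset_Ici.2 ha))).integrableOn_of_measure_ne_top
      (isLeast_Icc h.le) (isGreatest_Icc h.le) isCompact_Icc.measure_lt_top.ne
      measurableSet_Icc).mono_set Ico_subset_Icc_self

theorem monomial_succ_of_nonneg (n : ℕ) {t : ℝ} (ht : 0 ≤ t) :
    g.monomial 0 (n + 1) t = (n + 1) * ∫ s in Ico 0 t, g.monomial 0 n s ∂g.measure := by
  simp [Derivator.monomial, Derivator.integral, ht]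

theorem monomial_succ_sub_of_monotoneOn {n : ℕ} (hn : MonotoneOn (g.monomial 0 n) (Ici 0))
    {s t : ℝ} (hs : 0 ≤ s) (hst : s ≤ t) :
    g.monomial 0 (n + 1) t - g.monomial 0 (n + 1) s
      = (n + 1) * ∫ r in Ico s t, g.monomial 0 n r ∂g.measure := by
  rw [monomial_succ_of_nonneg n hs, monomial_succ_of_nonneg n (hs.trans hst),
    ← Ico_union_Ico_eq_Ico hs hst, setIntegral_union (Ico_disjoint_Ico_same) measurableSet_Ico
      (integrableOn_Ico_of_monotoneOn hn le_rfl) (integrableOn_Ico_of_monotoneOn hn hs)]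
  ring

/-- One induction serves both claims: monotonicity provides the integrability needed to subtract
integrals, and nonnegativity makes the next monomial monotone. -/
theorem monomial_nonneg_and_monotoneOn (n : ℕ) :
    (∀ t, 0 ≤ t → 0 ≤ g.monomial 0 n t) ∧ MonotoneOn (g.monomial 0 n) (Ici 0) := by
  induction n with
  | zero => exact ⟨fun _ _ => zero_le_one, fun _ _ _ _ _ => le_rfl⟩
  | succ n ih =>
    have key : ∀ s t, 0 ≤ s → 0 ≤ ∫ r in Ico s t, g.monomial 0 n r ∂g.measure := fun s t hs =>
      setIntegral_nonneg measurableSet_Ico fun r hr => ih.1 r (hs.trans hr.1)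
    refine ⟨fun t ht => ?_, fun s hs t ht hst => ?_⟩
    · rw [monomial_succ_of_nonneg n ht]
      exact mul_nonneg (by positivity) (key 0 t le_rfl)
    · rw [← sub_nonneg, monomial_succ_sub_of_monotoneOn ih.2 hs hst]
      exact mul_nonneg (by positivity) (key s t hs)

theorem monomial_nonneg (n : ℕ) {t : ℝ} (ht : 0 ≤ t) : 0 ≤ g.monomial 0 n t :=
  (monomial_nonneg_and_monotoneOn n).1 t ht

theorem monomial_monotoneOn (n : ℕ) : MonotoneOn (g.monomial 0 n) (Ici 0) :=
  (monomial_nonneg_and_monotoneOn n).2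

theorem monomial_succ_sub (n : ℕ) {s t : ℝ} (hs : 0 ≤ s) (hst : s ≤ t) :
    g.monomial 0 (n + 1) t - g.monomial 0 (n + 1) s
      = (n + 1) * ∫ r in Ico s t, g.monomial 0 n r ∂g.measure :=
  monomial_succ_sub_of_monotoneOn (monomial_monotoneOn n) hs hst

theorem setIntegral_const_Ico {s t : ℝ} (hst : s ≤ t) (C : ℝ) :
    ∫ _ in Ico s t, C ∂g.measure = (g t - g s) * C := by
  rw [setIntegral_const, measureReal_Ico hst, smul_eq_mul]

/-- Fubini's theorem applied to the product `g_{n+1} g` on the square `[0, t)²`. -/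
theorem monomial_succ_le_mul (hg0 : g 0 = 0) (n : ℕ) :
    ∀ t, 0 ≤ t → g.monomial 0 (n + 1) t ≤ g.monomial 0 n t * g t := by
  induction n with
  | zero =>
    intro t ht
    rw [monomial_succ_of_nonneg 0 ht]
    simp [Derivator.monomial, measureReal_Ico ht, hg0]
  | succ n ih =>
    intro t ht
    set ν := g.measure.restrict (Ico 0 t) with hν
    have : IsFiniteMeasure ν := ⟨by
      rw [hν, Measure.restrict_apply_univ, g.measure_Ico]; exact ENNReal.ofReal_lt_top⟩
    set f : ℝ → ℝ := fun r => (n + 1) * g.monomial 0 n r with hf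
    have hfi : Integrable f ν :=
      (integrableOn_Ico_of_monotoneOn (monomial_monotoneOn n) le_rfl).const_mul _
    have hf2 : Integrable (fun p : ℝ × ℝ => f p.2) (ν.prod ν) := hfi.comp_snd ν
    have hA : MeasurableSet {p : ℝ × ℝ | p.2 < p.1} := measurableSet_lt measurable_snd measurable_fst
    have hB : MeasurableSet {p : ℝ × ℝ | p.1 < p.2} := measurableSet_lt measurable_fst measurable_snd
    have hrestr : ∀ s ∈ Ico 0 t, ν.restrict (Iio s) = g.measure.restrict (Ico 0 s) := by
      intro s hs
      rw [hν, Measure.restrict_restrict measurableSet_Iio]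
      congr 1
      ext r
      simp only [mem_inter_iff, mem_Iio, mem_Ico]
      exact ⟨fun h => ⟨h.2.1, h.1⟩, fun h => ⟨h.2, h.1, h.2.trans hs.2⟩⟩
    have hIA : ∫ p, {p : ℝ × ℝ | p.2 < p.1}.indicator (fun p => f p.2) p ∂(ν.prod ν)
        = ∫ s in Ico 0 t, g.monomial 0 (n + 1) s ∂g.measure := by
      rw [integral_prod _ (hf2.indicator hA)]
      refine setIntegral_congr_fun measurableSet_Ico fun s hs => ?_
      have : ∀ r, {p : ℝ × ℝ | p.2 < p.1}.indicator (fun p => f p.2) (s, r)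
          = (Iio s).indicator f r := fun r => by simp [indicator]
      simp only [this]
      rw [integral_indicator measurableSet_Iio, hrestr s hs, hf, integral_const_mul,
        monomial_succ_of_nonneg n hs.1]
    have hIB : ∫ p, {p : ℝ × ℝ | p.1 < p.2}.indicator (fun p => f p.2) p ∂(ν.prod ν)
        = ∫ r in Ico 0 t, f r * g r ∂g.measure := by
      rw [integral_prod_symm _ (hf2.indicator hB)]
      refine setIntegral_congr_fun measurableSet_Ico fun r hr => ?_
      have : ∀ s, {p : ℝ × ℝ | p.1 < p.2}.indicator (fun p => f p.2) (s, r)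
          = (Iio r).indicator (fun _ => f r) s := fun s => by simp [indicator]
      simp only [this]
      rw [integral_indicator measurableSet_Iio, hrestr r hr, setIntegral_const_Ico hr.1, hg0]
      ring
    have hIT : ∫ p : ℝ × ℝ, f p.2 ∂(ν.prod ν) = g.monomial 0 (n + 1) t * g t := by
      rw [integral_prod _ hf2]
      simp only
      rw [hν, setIntegral_const_Ico ht, hf, integral_const_mul, monomial_succ_of_nonneg n ht, hg0]
      ring
    -- The two open triangles omit the diagonal, which has positive mass when `μ_g` has atoms; hence
    -- an inequality and not the classical identity.
    have hle : ∫ p, {p : ℝ × ℝ | p.2 < p.1}.indicator (fun p => f p.2) p ∂(ν.prod ν)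
        + ∫ p, {p : ℝ × ℝ | p.1 < p.2}.indicator (fun p => f p.2) p ∂(ν.prod ν)
        ≤ ∫ p : ℝ × ℝ, f p.2 ∂(ν.prod ν) := by
      rw [← integral_add (hf2.indicator hA) (hf2.indicator hB)]
      refine integral_mono_ae ((hf2.indicator hA).add (hf2.indicator hB)) hf2 ?_
      have hpos : ∀ᵐ r ∂ν, 0 ≤ f r := by
        filter_upwards [ae_restrict_mem measurableSet_Ico] with r hr
        exact mul_nonneg (by positivity) (monomial_nonneg n hr.1)
      filter_upwards [Measure.quasiMeasurePreserving_snd.ae hpos] with p hp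
      rcases lt_trichotomy p.1 p.2 with h | h | h
      · simp [indicator, h, h.not_gt]
      · simp [indicator, h, hp]
      · simp [indicator, h, h.not_gt]
    -- By induction the upper triangle contributes at least `n + 1` times the lower one, so together
    -- they reach `(n + 2) ∫ g_{n+1} = g_{n+2}`.
    have hgf : (n + 1 : ℝ) * ∫ s in Ico 0 t, g.monomial 0 (n + 1) s ∂g.measure
        ≤ ∫ r in Ico 0 t, f r * g r ∂g.measure := by
      rw [← integral_const_mul]
      have hmono : MonotoneOn (fun r => f r * g r) (Ici 0) := by
        intro r hr s hs hrs
        have h1 : 0 ≤ g r := hg0 ▸ g.mono hr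
        exact mul_le_mul (mul_le_mul_of_nonneg_left (monomial_monotoneOn n hr hs hrs)
          (by positivity)) (g.mono hrs) h1 (mul_nonneg (by positivity) (monomial_nonneg n hs))
      refine setIntegral_mono_on
        ((integrableOn_Ico_of_monotoneOn (monomial_monotoneOn (n + 1)) le_rfl).const_mul _)
        (integrableOn_Ico_of_monotoneOn hmono le_rfl) measurableSet_Ico fun r hr => ?_
      rw [hf, mul_assoc]
      exact mul_le_mul_of_nonneg_left (ih r hr.1) (by positivity)
    rw [monomial_succ_of_nonneg (n + 1) ht]
    push_cast
    linarith

theorem monomial_le_pow (hg0 : g 0 = 0) (n : ℕ) {t : ℝ} (ht : 0 ≤ t) :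
    g.monomial 0 n t ≤ g t ^ n := by
  induction n with
  | zero => simp [Derivator.monomial]
  | succ n ih =>
    rw [pow_succ]
    exact (monomial_succ_le_mul hg0 n t ht).trans
      (mul_le_mul_of_nonneg_right ih (hg0 ▸ g.mono ht))

/-- The formal derivative `p_k ↦ k p_{k-1}` on sequences of monomials. -/
def shift (p : ℕ → ℝ) (k : ℕ) : ℝ := k * p (k - 1)

variable {T : ℝ}

theorem abs_monomial_le (hg0 : g 0 = 0) {t : ℝ} (ht : t ∈ Icc 0 T) (k : ℕ) :
    |g.monomial 0 k t| ≤ g T ^ k := by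
  rw [abs_of_nonneg (monomial_nonneg k ht.1)]
  exact (monomial_le_pow hg0 k ht.1).trans (pow_le_pow_left₀ (hg0 ▸ g.mono ht.1) (g.mono ht.2) k)

theorem monomial_sub_le (hg0 : g 0 = 0) {s t : ℝ} (hs : 0 ≤ s) (hst : s ≤ t) (htT : t ≤ T)
    (k : ℕ) : g.monomial 0 k t - g.monomial 0 k s ≤ shift (fun k => g T ^ k) k * (g t - g s) := by
  cases k with
  | zero => simp [Derivator.monomial, shift]
  | succ k =>
    rw [monomial_succ_sub k hs hst, shift, Nat.add_sub_cancel]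
    push_cast
    rw [mul_assoc]
    refine mul_le_mul_of_nonneg_left ?_ (by positivity)
    rw [mul_comm, ← setIntegral_const_Ico hst]
    refine setIntegral_mono_on (integrableOn_Ico_of_monotoneOn (monomial_monotoneOn k) hs)
      (integrableOn_Ico_of_monotoneOn (fun _ _ _ _ _ => le_rfl) hs) measurableSet_Ico fun r hr => ?_
    exact (le_abs_self _).trans (abs_monomial_le hg0 ⟨hs.trans hr.1, hr.2.le.trans htT⟩ k)

theorem monomial_eq_of_eq (hg0 : g 0 = 0) {s t : ℝ} (hs : 0 ≤ s) (ht : 0 ≤ t) (h : g s = g t)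
    (k : ℕ) : g.monomial 0 k s = g.monomial 0 k t := by
  wlog hst : s ≤ t generalizing s t
  · exact (this ht hs h.symm (le_of_not_ge hst)).symm
  have h1 := monomial_sub_le hg0 hs hst le_rfl k
  rw [h, sub_self, mul_zero] at h1
  linarith [monomial_monotoneOn (g := g) k hs ht hst]

theorem setIntegral_monomial_sub (k : ℕ) {s t : ℝ} (C : ℝ) (hs : 0 ≤ s) (hst : s ≤ t) :
    g.monomial 0 (k + 1) t - g.monomial 0 (k + 1) s - (g t - g s) * ((k + 1) * C)
      = (k + 1) * ∫ r in Ico s t, (g.monomial 0 k r - C) ∂g.measure := by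
  rw [integral_sub (integrableOn_Ico_of_monotoneOn (monomial_monotoneOn k) hs)
    (integrableOn_Ico_of_monotoneOn (fun _ _ _ _ _ => le_rfl) hs), setIntegral_const_Ico hst,
    monomial_succ_sub k hs hst]
  ring

/-- The remainder is a multiple of the integral of `g_k - g_k(b)` over `[b, s)`. The integrand
vanishes at `b`, so the atom there drops out and only the mass `g(s) - g(b⁺)` of `(b, s)` counts;
the Lipschitz bound on `g_k` supplies the other factor. -/
theorem abs_monomial_taylor_right (hg0 : g 0 = 0) {b s : ℝ} (hb : b ∈ Icc 0 T) (hs : s ∈ Icc 0 T)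
    (hbs : b < s) (k : ℕ) :
    |g.monomial 0 k s - g.monomial 0 k b - (g s - g b) * shift (fun k => g.monomial 0 k b) k|
      ≤ |g s - g b| * (g s - Function.rightLim g b) * shift (shift fun k => g T ^ k) k := by
  cases k with
  | zero => simp [Derivator.monomial, shift]
  | succ k =>
    have hgd : 0 ≤ g s - g b := sub_nonneg.2 (g.mono hbs.le)
    simp only [shift, Nat.add_sub_cancel]
    push_cast
    rw [setIntegral_monomial_sub k _ hb.1 hbs.le, abs_of_nonneg hgd, abs_mul,
      abs_of_nonneg (by positivity : (0:ℝ) ≤ k + 1)]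
    have h1 : ∫ r in Ico b s, (g.monomial 0 k r - g.monomial 0 k b) ∂g.measure
        = ∫ r in Ioo b s, (g.monomial 0 k r - g.monomial 0 k b) ∂g.measure := by
      refine setIntegral_eq_of_subset_of_forall_sdiff_eq_zero measurableSet_Ico
        Ioo_subset_Ico_self fun r hr => ?_
      have : r = b := by
        by_contra hne
        exact hr.2 ⟨lt_of_le_of_ne hr.1.1 (Ne.symm hne), hr.1.2⟩
      rw [this, sub_self]
    have h2 := norm_setIntegral_le_of_norm_le_const (μ := g.measure) (s := Ioo b s)
      (f := fun r => g.monomial 0 k r - g.monomial 0 k b)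
      (C := shift (fun k => g T ^ k) k * (g s - g b))
      (measure_lt_top_of_subset Ioo_subset_Icc_self isCompact_Icc.measure_lt_top.ne) (by
        intro r hr
        rw [Real.norm_eq_abs, abs_of_nonneg (sub_nonneg.2
          (monomial_monotoneOn k hb.1 (hb.1.trans hr.1.le) hr.1.le))]
        refine (sub_le_sub_right (monomial_monotoneOn k (hb.1.trans hr.1.le) hs.1 hr.2.le) _).trans
          (monomial_sub_le hg0 hb.1 hbs.le hs.2 k))
    rw [h1]
    rw [Real.norm_eq_abs, measureReal_Ioo hbs, shift] at h2
    calc _ ≤ (k + 1 : ℝ) * _ := mul_le_mul_of_nonneg_left h2 (by positivity)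
      _ = _ := by ring

theorem abs_monomial_taylor_left (hg0 : g 0 = 0) {b s : ℝ} (hb : b ∈ Icc 0 T) (hs : s ∈ Icc 0 T)
    (hsb : s < b) (k : ℕ) :
    |g.monomial 0 k s - g.monomial 0 k b - (g s - g b) * shift (fun k => g.monomial 0 k b) k|
      ≤ |g s - g b| * (g b - g s) * shift (shift fun k => g T ^ k) k := by
  cases k with
  | zero => simp [Derivator.monomial, shift]
  | succ k =>
    have hgd : 0 ≤ g b - g s := sub_nonneg.2 (g.mono hsb.le)
    have h0 : ∀ x : ℝ, g.monomial 0 (k + 1) s - g.monomial 0 (k + 1) b - (g s - g b) * x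
      = -(g.monomial 0 (k + 1) b - g.monomial 0 (k + 1) s - (g b - g s) * x) := fun x => by ring
    simp only [shift, Nat.add_sub_cancel]
    push_cast
    rw [h0, abs_neg, setIntegral_monomial_sub k _ hs.1 hsb.le, abs_sub_comm (g s),
      abs_of_nonneg hgd, abs_mul, abs_of_nonneg (by positivity : (0:ℝ) ≤ k + 1)]
    have h2 := norm_setIntegral_le_of_norm_le_const (μ := g.measure) (s := Ico s b)
      (f := fun r => g.monomial 0 k r - g.monomial 0 k b)
      (C := shift (fun k => g T ^ k) k * (g b - g s))
      (measure_lt_top_of_subset Ico_subset_Icc_self isCompact_Icc.measure_lt_top.ne) (by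
        intro r hr
        rw [norm_sub_rev, Real.norm_eq_abs, abs_of_nonneg (sub_nonneg.2
          (monomial_monotoneOn k (hs.1.trans hr.1) hb.1 hr.2.le))]
        refine (sub_le_sub_left (monomial_monotoneOn k hs.1 (hs.1.trans hr.1) hr.1) _).trans
          (monomial_sub_le hg0 hs.1 hsb.le hb.2 k))
    rw [Real.norm_eq_abs, measureReal_Ico hsb.le, shift] at h2
    calc _ ≤ (k + 1 : ℝ) * _ := mul_le_mul_of_nonneg_left h2 (by positivity)
      _ = _ := by ring

end Monomial

/-! ### Algebra of the heat polynomials and their generating function bound. -/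

section HeatSum

/-- The heat polynomial with the monomials replaced by arbitrary sequences `p` and `q`. -/
noncomputable def heatSum (c : ℝ) (p q : ℕ → ℝ) (n : ℕ) : ℝ :=
  ∑ k ∈ Finset.range (n / 2 + 1),
    ((n ! : ℝ) * c ^ (2 * k)) / (((n - 2 * k)! : ℝ) * (k ! : ℝ)) * p k * q (n - 2 * k)

theorem heatPoly_eq_heatSum (c : ℝ) (g h : Derivator) (n : ℕ) (t x : ℝ) :
    heatPoly c g h n t x
      = heatSum c (fun k => g.monomial 0 k t) (fun k => h.monomial 0 k x) n := rfl

variable {c : ℝ} {p p' q q' P Q : ℕ → ℝ}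

theorem heatSum_sub_sub_left (δ : ℝ) (r : ℕ → ℝ) (n : ℕ) :
    heatSum c (fun k => p' k - p k - δ * r k) q n
      = heatSum c p' q n - heatSum c p q n - δ * heatSum c r q n := by
  simp only [heatSum, Finset.mul_sum, ← Finset.sum_sub_distrib]
  exact Finset.sum_congr rfl fun k _ => by ring

theorem heatSum_sub_sub_right (δ : ℝ) (r : ℕ → ℝ) (n : ℕ) :
    heatSum c p (fun k => q' k - q k - δ * r k) n
      = heatSum c p q' n - heatSum c p q n - δ * heatSum c p r n := by
  simp only [heatSum, Finset.mul_sum, ← Finset.sum_sub_distrib]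
  exact Finset.sum_congr rfl fun k _ => by ring

theorem heatSum_mul_left (ε : ℝ) (n : ℕ) :
    heatSum c (fun k => ε * p k) q n = ε * heatSum c p q n := by
  simp only [heatSum, Finset.mul_sum]
  exact Finset.sum_congr rfl fun k _ => by ring

theorem heatSum_mul_right (ε : ℝ) (n : ℕ) :
    heatSum c p (fun k => ε * q k) n = ε * heatSum c p q n := by
  simp only [heatSum, Finset.mul_sum]
  exact Finset.sum_congr rfl fun k _ => by ring

theorem abs_heatSum_le (hc : 0 ≤ c) (hp : ∀ k, |p k| ≤ P k) (hq : ∀ k, |q k| ≤ Q k) (n : ℕ) :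
    |heatSum c p q n| ≤ heatSum c P Q n := by
  refine (Finset.abs_sum_le_sum_abs _ _).trans (Finset.sum_le_sum fun k _ => ?_)
  have h0 : 0 ≤ ((n ! : ℝ) * c ^ (2 * k)) / (((n - 2 * k)! : ℝ) * (k ! : ℝ)) := by positivity
  rw [abs_mul, abs_mul, abs_of_nonneg h0]
  exact mul_le_mul (mul_le_mul_of_nonneg_left (hp k) h0) (hq _) (abs_nonneg _)
    (mul_nonneg h0 ((abs_nonneg _).trans (hp k)))

/-- The factor `k` kills the first summand and lowers `k!`; reindexing `k ↦ k + 1` leaves `v_{n-2}`.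
For `n < 2` both sides vanish. -/
theorem heatSum_shift_left (n : ℕ) :
    heatSum c (shift p) q n = c ^ 2 * n.descFactorial 2 * heatSum c p q (n - 2) := by
  rcases n with _ | _ | m
  · simp [heatSum, shift]
  · simp [heatSum, shift]
  have h2 : (m + 1 + 1) / 2 + 1 = (m / 2 + 1) + 1 := by omega
  have h3 : m + 1 + 1 - 2 = m := by omega
  rw [heatSum, h2, Finset.sum_range_succ', h3, heatSum, Finset.mul_sum]
  simp only [shift, Nat.cast_zero, zero_mul, mul_zero, add_zero, Nat.add_sub_cancel]
  refine Finset.sum_congr rfl fun k _ => ?_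
  have h4 : m + 1 + 1 - 2 * (k + 1) = m - 2 * k := by omega
  rw [h4, Nat.factorial_succ, Nat.factorial_succ m, Nat.factorial_succ k]
  simp only [Nat.succ_descFactorial_succ, Nat.descFactorial_zero]
  push_cast
  have := Nat.factorial_pos k
  have := Nat.factorial_pos (m - 2 * k)
  field_simp
  ring

theorem heatSum_shift_right (n : ℕ) :
    heatSum c p (shift q) n = n.descFactorial 1 * heatSum c p q (n - 1) := by
  rcases n with _ | m
  · simp [heatSum, shift]
  have key : ∀ k, 2 * k ≤ m →
      (((m + 1)! : ℝ) * c ^ (2 * k)) / (((m + 1 - 2 * k)! : ℝ) * (k ! : ℝ)) * p k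
          * shift q (m + 1 - 2 * k)
        = (m + 1) * (((m ! : ℝ) * c ^ (2 * k)) / (((m - 2 * k)! : ℝ) * (k ! : ℝ)) * p k
          * q (m - 2 * k)) := by
    intro k hk
    have h4 : m + 1 - 2 * k = (m - 2 * k) + 1 := by omega
    rw [h4, shift, Nat.factorial_succ, Nat.factorial_succ, Nat.add_sub_cancel]
    push_cast
    have := Nat.factorial_pos k
    have := Nat.factorial_pos (m - 2 * k)
    field_simp
  simp only [Nat.descFactorial_one, Nat.add_sub_cancel]
  push_cast
  rw [heatSum, heatSum, Finset.mul_sum]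
  -- For odd `m` the left sum has one summand more, at the degree-zero monomial in space, which the
  -- shift annihilates.
  rcases Nat.even_or_odd' m with ⟨j, rfl | rfl⟩
  · have h1 : (2 * j + 1) / 2 = 2 * j / 2 := by omega
    rw [h1]
    refine Finset.sum_congr rfl fun k hk => ?_
    rw [Finset.mem_range] at hk
    exact_mod_cast key k (by omega)
  · have h1 : (2 * j + 1 + 1) / 2 = (2 * j + 1) / 2 + 1 := by omega
    rw [h1, Finset.sum_range_succ]
    have h2 : 2 * j + 1 + 1 - 2 * ((2 * j + 1) / 2 + 1) = 0 := by omega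
    rw [h2]
    simp only [shift, Nat.cast_zero, zero_mul, mul_zero, add_zero]
    refine Finset.sum_congr rfl fun k hk => ?_
    rw [Finset.mem_range] at hk
    exact_mod_cast key k (by omega)

theorem descFactorial_mul_cast (n m j : ℕ) :
    (n.descFactorial m : ℝ) * ((n - m).descFactorial j : ℝ) = n.descFactorial (m + j) := by
  have := Nat.descFactorial_mul_descFactorial (n := n) (Nat.le_add_right m j)
  rw [Nat.add_sub_cancel_left] at this
  rw [mul_comm]
  exact_mod_cast this

/-- Linearity in `p` carries the monomial expansion over; the double shift in the remainder becomes
two formal time derivatives. -/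
theorem abs_heatSum_taylor_left (hc : 0 ≤ c) {δ ε : ℝ}
    (hp : ∀ k, |p' k - p k - δ * shift p k| ≤ ε * shift (shift P) k) (hq : ∀ k, |q k| ≤ Q k)
    (n : ℕ) :
    |heatSum c p' q n - heatSum c p q n - δ * (c ^ 2 * n.descFactorial 2 * heatSum c p q (n - 2))|
      ≤ ε * (c ^ 4 * n.descFactorial 4 * heatSum c P Q (n - 4)) := by
  have h := abs_heatSum_le hc hp hq n
  rw [heatSum_sub_sub_left, heatSum_mul_left, heatSum_shift_left, heatSum_shift_left,
    heatSum_shift_left] at h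
  refine h.trans_eq ?_
  rw [← descFactorial_mul_cast n 2 2, show n - 2 - 2 = n - 4 by omega]
  ring

theorem abs_heatSum_taylor_right (hc : 0 ≤ c) {δ ε : ℝ}
    (hp : ∀ k, |p k| ≤ P k) (hq : ∀ k, |q' k - q k - δ * shift q k| ≤ ε * shift (shift Q) k)
    (n : ℕ) :
    |heatSum c p q' n - heatSum c p q n - δ * (n.descFactorial 1 * heatSum c p q (n - 1))|
      ≤ ε * (n.descFactorial 2 * heatSum c P Q (n - 2)) := by
  have h := abs_heatSum_le hc hp hq n
  rw [heatSum_sub_sub_right, heatSum_mul_right, heatSum_shift_right, heatSum_shift_right,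
    heatSum_shift_right] at h
  refine h.trans_eq ?_
  rw [← descFactorial_mul_cast n 1 1, show n - 1 - 1 = n - 2 by omega]
  ring

/-- After division by `n!`, the left side is the coefficient of degree `n` in the product of the
series of `exp(c² G r²)` and `exp(H r)`, graded by powers of `r`; all terms are nonnegative. -/
theorem heatSum_pow_mul_pow_le {G H r : ℝ} (hG : 0 ≤ G) (hH : 0 ≤ H) (hr : 0 ≤ r) (n : ℕ) :
    heatSum c (fun k => G ^ k) (fun k => H ^ k) n * r ^ n
      ≤ n ! * Real.exp (c ^ 2 * G * r ^ 2 + H * r) := by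
  have h1 : heatSum c (fun k => G ^ k) (fun k => H ^ k) n * r ^ n
      = n ! * ∑ k ∈ Finset.range (n / 2 + 1),
        (c ^ 2 * G * r ^ 2) ^ k / k ! * ((H * r) ^ (n - 2 * k) / (n - 2 * k)!) := by
    rw [heatSum, Finset.sum_mul, Finset.mul_sum]
    refine Finset.sum_congr rfl fun k hk => ?_
    rw [Finset.mem_range] at hk
    have h2 : r ^ n = r ^ (2 * k) * r ^ (n - 2 * k) := by rw [← pow_add]; congr 1; omega
    rw [h2, mul_pow, mul_pow, mul_pow, pow_mul, pow_mul]
    field_simp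
  rw [h1, Real.exp_add]
  refine mul_le_mul_of_nonneg_left ?_ (by positivity)
  calc _ ≤ ∑ k ∈ Finset.range (n / 2 + 1),
        (c ^ 2 * G * r ^ 2) ^ k / k ! * Real.exp (H * r) :=
        Finset.sum_le_sum fun k _ => mul_le_mul_of_nonneg_left
          (Real.pow_div_factorial_le_exp _ (by positivity) _) (by positivity)
    _ ≤ _ := by
        rw [← Finset.sum_mul]
        exact mul_le_mul_of_nonneg_right (Real.sum_le_exp_of_nonneg (by positivity) _)
          (Real.exp_pos _).le

end HeatSum

/-! ### Summability of the majorants below the critical time. -/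

section Summability

theorem factorial_le_mul_pow {n : ℕ} (hn : n ≠ 0) :
    (n ! : ℝ) ≤ Real.exp 1 * n * (n / Real.exp 1) ^ n := by
  obtain ⟨m, rfl⟩ := Nat.exists_eq_succ_of_ne_zero hn
  have h : Stirling.stirlingSeq (m + 1) ≤ Stirling.stirlingSeq 1 :=
    Stirling.stirlingSeq'_antitone (Nat.zero_le m)
  rw [Stirling.stirlingSeq_one, Stirling.stirlingSeq] at h
  rw [div_le_iff₀ (by positivity)] at h
  refine h.trans ?_
  have h1 : √(2 * ((m.succ : ℕ) : ℝ)) ≤ √2 * (m.succ : ℕ) := by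
    rw [Real.sqrt_mul (by norm_num)]
    refine mul_le_mul_of_nonneg_left (Real.sqrt_le_iff.2 ⟨by positivity, ?_⟩) (by positivity)
    push_cast; nlinarith [(Nat.cast_nonneg m : (0:ℝ) ≤ m)]
  have h2 : 0 < √2 := by positivity
  rw [← mul_assoc]
  refine mul_le_mul_of_nonneg_right ?_ (by positivity)
  rw [div_mul_eq_mul_div, div_le_iff₀ h2]
  nlinarith [Real.exp_pos 1]

/-- Any real `ρ` strictly between `c² G` and `σ` works: the limit superior is below `1/ρ`, so
eventually the terms are too. -/
theorem exists_eventually_norm_sq_le {𝔽 : Type*} [RCLike 𝔽] {α : ℕ → 𝔽} {G c : ℝ} (hc : 0 < c)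
    (hσ : ENNReal.ofReal G < sigma α / ENNReal.ofReal (c ^ 2)) :
    ∃ ρ : ℝ, c ^ 2 * G < ρ ∧ 0 < ρ ∧
      ∀ᶠ n : ℕ in atTop, ‖α n‖ ^ 2 ≤ (Real.exp 1 / (2 * n * ρ)) ^ n := by
  have hc2 : 0 < c ^ 2 := by positivity
  rw [ENNReal.lt_div_iff_mul_lt (Or.inl (ENNReal.ofReal_pos.2 hc2).ne')
    (Or.inl ENNReal.ofReal_ne_top), mul_comm, ← ENNReal.ofReal_mul hc2.le] at hσ
  obtain ⟨ρ, hρ0, h1, h2⟩ := ENNReal.lt_iff_exists_real_btwn.1 hσ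
  have hρ : 0 < ρ := ENNReal.ofReal_pos.1 (bot_le.trans_lt h1)
  refine ⟨ρ, (ENNReal.ofReal_lt_ofReal_iff hρ).1 h1, hρ, ?_⟩
  rw [sigma, ENNReal.lt_inv_iff_lt_inv, ← ENNReal.ofReal_inv_of_pos hρ] at h2
  filter_upwards [eventually_lt_of_limsup_lt h2, eventually_gt_atTop 0] with n hn hn0
  have h3 := (ENNReal.ofReal_lt_ofReal_iff (inv_pos.2 hρ)).1 hn
  have hn' : (0 : ℝ) < n := by exact_mod_cast hn0
  have h4 : ‖α n‖ ^ ((2 : ℝ) / n) ≤ Real.exp 1 / (2 * n * ρ) := by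
    rw [div_lt_iff₀ (Real.exp_pos 1)] at h3
    rw [le_div_iff₀ (by positivity)]
    have h5 := mul_lt_mul_of_pos_right h3 hρ
    have h6 : ρ⁻¹ * Real.exp 1 * ρ = Real.exp 1 := by field_simp
    linarith
  calc ‖α n‖ ^ 2 = (‖α n‖ ^ ((2 : ℝ) / n)) ^ n := by
        rw [← Real.rpow_natCast (‖α n‖ ^ ((2 : ℝ) / n)), ← Real.rpow_mul (norm_nonneg _),
          div_mul_cancel₀ _ hn'.ne', Real.rpow_two]
    _ ≤ _ := pow_le_pow_left₀ (by positivity) h4 n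

/-- The bound for the terms of the series with `a` derivatives in time and weighted order `m`. -/
noncomputable def termBound {𝔽 : Type*} [RCLike 𝔽] (α : ℕ → 𝔽) (c G H : ℝ) (a m n : ℕ) : ℝ :=
  ‖α n‖ * (c ^ (2 * a) * n.descFactorial m
    * heatSum c (fun k => G ^ k) (fun k => H ^ k) (n - m))

variable {𝔽 : Type*} [RCLike 𝔽] {α : ℕ → 𝔽} {c G H : ℝ}

theorem heatSum_pow_nonneg (hc : 0 ≤ c) (hG : 0 ≤ G) (hH : 0 ≤ H) (n : ℕ) :
    0 ≤ heatSum c (fun k => G ^ k) (fun k => H ^ k) n :=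
  Finset.sum_nonneg fun k _ => by positivity

theorem termBound_nonneg (hc : 0 ≤ c) (hG : 0 ≤ G) (hH : 0 ≤ H) (a m n : ℕ) :
    0 ≤ termBound α c G H a m n := by
  have := heatSum_pow_nonneg hc hG hH (n - m)
  unfold termBound
  positivity

theorem descFactorial_mul_heatSum_le (hG : 0 ≤ G) (hH : 0 ≤ H) {r : ℝ}
    (hr : 0 < r) (m n : ℕ) :
    n.descFactorial m * heatSum c (fun k => G ^ k) (fun k => H ^ k) (n - m)
      ≤ n ! * Real.exp (c ^ 2 * G * r ^ 2 + H * r) * r ^ m / r ^ n := by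
  rcases lt_or_ge n m with h | h
  · rw [Nat.descFactorial_of_lt h, Nat.cast_zero, zero_mul]
    positivity
  · rw [le_div_iff₀ (by positivity)]
    have h1 := heatSum_pow_mul_pow_le (c := c) hG hH hr.le (n - m)
    have h2 : r ^ n = r ^ (n - m) * r ^ m := by rw [← pow_add, Nat.sub_add_cancel h]
    have h3 : (n ! : ℝ) = (n - m)! * n.descFactorial m := by
      exact_mod_cast (Nat.factorial_mul_descFactorial h).symm
    rw [h2, h3]
    calc _ = (n.descFactorial m : ℝ) * (heatSum c (fun k => G ^ k) (fun k => H ^ k) (n - m)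
          * r ^ (n - m)) * r ^ m := by ring
      _ ≤ (n.descFactorial m : ℝ) * ((n - m)! * Real.exp (c ^ 2 * G * r ^ 2 + H * r)) * r ^ m := by
          gcongr
      _ = _ := by ring

theorem summable_termBound (hc : 0 < c) (hG : 0 ≤ G) (hH : 0 ≤ H)
    (hσ : ENNReal.ofReal G < sigma α / ENNReal.ofReal (c ^ 2)) (a m : ℕ) :
    Summable (termBound α c G H a m) := by
  obtain ⟨ρ, hρG, hρ, hev⟩ := exists_eventually_norm_sq_le hc hσ
  obtain ⟨A, hA1, hA2⟩ := exists_between (max_lt hρG hρ)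
  have hA : 0 < A := (le_max_right _ _).trans_lt hA1
  have hGA : c ^ 2 * G ≤ A := (le_max_left _ _).trans hA1.le
  -- The gap between `A` and `ρ` gains a factor `exp(-2ε)` per degree; half of it will pay for
  -- `exp(H r)`, the other half gives the convergence.
  obtain ⟨ε, hε, hεq⟩ : ∃ ε : ℝ, 0 < ε ∧ Real.exp (-2 * ε) ^ 2 = A / ρ := by
    refine ⟨-Real.log (A / ρ) / 4, ?_, ?_⟩
    · have := Real.log_neg (div_pos hA hρ) ((div_lt_one hρ).2 hA2)
      linarith
    · rw [← Real.exp_nat_mul, ← Real.exp_log (div_pos hA hρ), Real.log_exp]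
      congr 1; push_cast; ring
  -- The radius `r = κ √n` minimizes `exp(A r²) / r^n`.
  set κ : ℝ := 1 / √(2 * A) with hκ
  have hκ0 : 0 < κ := by positivity
  have hκ2 : κ ^ 2 = 1 / (2 * A) := by rw [hκ, div_pow, one_pow, Real.sq_sqrt (by positivity)]
  set M : ℝ := (H * κ) ^ 2 / (4 * ε) with hM
  have hlim : Summable fun n : ℕ => c ^ (2 * a) * Real.exp 1 * Real.exp M * κ ^ m *
      ((n : ℝ) ^ (m + 1) * Real.exp (-ε) ^ n) := by
    refine Summable.mul_left _ (summable_pow_mul_geometric_of_norm_lt_one (m + 1) ?_)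
    rw [Real.norm_eq_abs, abs_of_pos (Real.exp_pos _), Real.exp_lt_one_iff]
    linarith
  refine hlim.of_norm_bounded_eventually_nat ?_
  filter_upwards [hev, eventually_gt_atTop 0] with n hn hn0
  have hn1 : (1 : ℝ) ≤ n := by exact_mod_cast hn0
  have hn' : (0 : ℝ) < n := by linarith
  rw [Real.norm_of_nonneg (termBound_nonneg hc.le hG hH a m n)]
  set r : ℝ := κ * √n with hr
  have hr0 : 0 < r := by positivity
  have hr2 : r ^ 2 = n / (2 * A) := by
    rw [hr, mul_pow, hκ2, Real.sq_sqrt hn'.le]; ring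
  set E : ℝ := Real.exp (1 / 2) with hE
  have hE0 : 0 < E := Real.exp_pos _
  have hE2 : E ^ 2 = Real.exp 1 := by rw [hE, ← Real.exp_nat_mul]; congr 1; norm_num
  set q : ℝ := Real.exp (-2 * ε) with hq
  have hq0 : 0 < q := Real.exp_pos _
  have hroot : ‖α n‖ / r ^ n ≤ (E * q / n) ^ n := by
    refine le_of_sq_le_sq ?_ (by positivity)
    calc (‖α n‖ / r ^ n) ^ 2 = ‖α n‖ ^ 2 / (r ^ 2) ^ n := by rw [div_pow, pow_right_comm]
      _ ≤ (Real.exp 1 / (2 * n * ρ)) ^ n / (r ^ 2) ^ n := by gcongr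
      _ = ((E * q / n) ^ n) ^ 2 := by
        rw [← div_pow, pow_right_comm (E * q / n), div_pow (E * q), mul_pow E, hE2, hεq, hr2]
        congr 1
        field_simp
  have hexp1 : Real.exp (c ^ 2 * G * r ^ 2) ≤ E ^ n := by
    rw [hE, ← Real.exp_nat_mul, Real.exp_le_exp, hr2]
    calc c ^ 2 * G * (n / (2 * A)) ≤ A * (n / (2 * A)) := by gcongr
      _ = n * (1 / 2) := by field_simp
  -- Completing the square: `H κ √n ≤ (H κ)² / (4 ε) + ε n`.
  have hexp2 : Real.exp (H * r) ≤ Real.exp M * Real.exp ε ^ n := by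
    rw [← Real.exp_nat_mul, ← Real.exp_add, Real.exp_le_exp, hM, hr, div_add' _ _ _ (by positivity),
      le_div_iff₀ (by positivity)]
    have := sq_nonneg (H * κ - 2 * ε * √n)
    have h2 : (2 * ε * √n) ^ 2 = n * ε * (4 * ε) := by
      rw [mul_pow, Real.sq_sqrt hn'.le]; ring
    nlinarith
  have hrm : r ^ m ≤ κ ^ m * (n : ℝ) ^ m := by
    rw [← mul_pow]
    exact pow_le_pow_left₀ hr0.le
      (mul_le_mul_of_nonneg_left (Real.sqrt_le_iff.2 ⟨hn'.le, by nlinarith⟩) hκ0.le) m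
  calc termBound α c G H a m n
      = ‖α n‖ * c ^ (2 * a) * (n.descFactorial m
        * heatSum c (fun k => G ^ k) (fun k => H ^ k) (n - m)) := by rw [termBound]; ring
    _ ≤ ‖α n‖ * c ^ (2 * a) * (n ! * Real.exp (c ^ 2 * G * r ^ 2 + H * r) * r ^ m / r ^ n) :=
        mul_le_mul_of_nonneg_left (descFactorial_mul_heatSum_le hG hH hr0 m n) (by positivity)
    _ = c ^ (2 * a) * (‖α n‖ / r ^ n) * n ! * Real.exp (c ^ 2 * G * r ^ 2) * Real.exp (H * r)
        * r ^ m := by rw [Real.exp_add]; ring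
    _ ≤ c ^ (2 * a) * (E * q / n) ^ n * (Real.exp 1 * n * (n / Real.exp 1) ^ n) * E ^ n
        * (Real.exp M * Real.exp ε ^ n) * (κ ^ m * (n : ℝ) ^ m) := by
        have := factorial_le_mul_pow hn0.ne'
        gcongr
    _ = c ^ (2 * a) * Real.exp 1 * Real.exp M * κ ^ m * ((n : ℝ) ^ (m + 1)
        * ((E * q / n) * (n / Real.exp 1) * E * Real.exp ε) ^ n) := by
        simp only [mul_pow]; ring
    _ = _ := by
        congr 3
        have h1 : Real.exp (-ε) = q * Real.exp ε := by rw [hq, ← Real.exp_add]; congr 1; ring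
        rw [h1, ← hE2]
        field_simp

end Summability

/-! ### Termwise differentiation and the heat equation. -/

section Series

variable {𝔽 : Type*} [RCLike 𝔽]

/-- The term `αₙ vₙ` of the series, differentiated `a` times in time and `m - 2 a` times in
space. -/
noncomputable def termPartial (α : ℕ → 𝔽) (c : ℝ) (g h : Derivator) (a m n : ℕ) (t x : ℝ) : 𝔽 :=
  α n * ((c ^ (2 * a) * n.descFactorial m * heatPoly c g h (n - m) t x : ℝ) : 𝔽)

/-- The sum of the series of the differentiated terms. -/
noncomputable def seriesPartial (α : ℕ → 𝔽) (c : ℝ) (g h : Derivator) (a m : ℕ) (t x : ℝ) : 𝔽 :=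
  ∑' n, termPartial α c g h a m n t x

variable {α : ℕ → 𝔽} {c T L : ℝ} {g h : Derivator}

theorem norm_termPartial_le (hc : 0 ≤ c) (hg0 : g 0 = 0) (hh0 : h 0 = 0) (a m n : ℕ) {t x : ℝ}
    (ht : t ∈ Icc 0 T) (hx : x ∈ Icc 0 L) :
    ‖termPartial α c g h a m n t x‖ ≤ termBound α c (g T) (h L) a m n := by
  rw [termPartial, norm_mul, RCLike.norm_ofReal, abs_mul,
    abs_of_nonneg (by positivity : (0:ℝ) ≤ c ^ (2 * a) * n.descFactorial m)]
  refine mul_le_mul_of_nonneg_left (mul_le_mul_of_nonneg_left ?_ (by positivity)) (norm_nonneg _)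
  exact abs_heatSum_le hc (abs_monomial_le hg0 ht) (abs_monomial_le hh0 hx) _

theorem norm_mul_ofReal_taylor_le {z : 𝔽} {C X Y Z δ R : ℝ} (hC : 0 ≤ C)
    (H : |X - Y - δ * Z| ≤ R) :
    ‖z * ((C * X : ℝ) : 𝔽) - z * ((C * Y : ℝ) : 𝔽) - δ • (z * ((C * Z : ℝ) : 𝔽))‖
      ≤ ‖z‖ * (C * R) := by
  have h1 : z * ((C * X : ℝ) : 𝔽) - z * ((C * Y : ℝ) : 𝔽) - δ • (z * ((C * Z : ℝ) : 𝔽))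
      = z * ((C * (X - Y - δ * Z) : ℝ) : 𝔽) := by
    rw [RCLike.real_smul_eq_coe_mul]
    push_cast
    ring
  rw [h1, norm_mul, RCLike.norm_ofReal, abs_mul, abs_of_nonneg hC]
  gcongr

theorem norm_termPartial_taylor_time (hc : 0 ≤ c) (hh0 : h 0 = 0) (a m n : ℕ) {b s x e : ℝ}
    (hx : x ∈ Icc 0 L)
    (H : ∀ k, |g.monomial 0 k s - g.monomial 0 k b
        - (g s - g b) * shift (fun k => g.monomial 0 k b) k|
      ≤ |g s - g b| * e * shift (shift fun k => g T ^ k) k) :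
    ‖termPartial α c g h a m n s x - termPartial α c g h a m n b x
        - (g s - g b) • termPartial α c g h (a + 1) (m + 2) n b x‖
      ≤ termBound α c (g T) (h L) (a + 2) (m + 4) n * |g s - g b| * e := by
  have h1 := abs_heatSum_taylor_left hc H (abs_monomial_le (T := L) hh0 hx) (n - m)
  have h2 := norm_mul_ofReal_taylor_le (z := α n)
    (by positivity : (0:ℝ) ≤ c ^ (2 * a) * n.descFactorial m) h1
  have h3 : c ^ (2 * a) * (n.descFactorial m : ℝ) * (c ^ 2 * (n - m).descFactorial 2
      * heatSum c (fun k => g.monomial 0 k b) (fun k => h.monomial 0 k x) (n - m - 2))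
      = c ^ (2 * (a + 1)) * n.descFactorial (m + 2) * heatPoly c g h (n - (m + 2)) b x := by
    rw [← descFactorial_mul_cast, heatPoly_eq_heatSum, Nat.sub_sub]; ring
  rw [h3] at h2
  refine h2.trans_eq ?_
  rw [termBound, ← descFactorial_mul_cast, Nat.sub_sub]
  ring

theorem norm_termPartial_taylor_space (hc : 0 ≤ c) (hg0 : g 0 = 0) (a m n : ℕ) {b s t e : ℝ}
    (ht : t ∈ Icc 0 T)
    (H : ∀ k, |h.monomial 0 k s - h.monomial 0 k b
        - (h s - h b) * shift (fun k => h.monomial 0 k b) k|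
      ≤ |h s - h b| * e * shift (shift fun k => h L ^ k) k) :
    ‖termPartial α c g h a m n t s - termPartial α c g h a m n t b
        - (h s - h b) • termPartial α c g h a (m + 1) n t b‖
      ≤ termBound α c (g T) (h L) a (m + 2) n * |h s - h b| * e := by
  have h1 := abs_heatSum_taylor_right hc (abs_monomial_le (T := T) hg0 ht) H (n - m)
  have h2 := norm_mul_ofReal_taylor_le (z := α n)
    (by positivity : (0:ℝ) ≤ c ^ (2 * a) * n.descFactorial m) h1
  have h3 : c ^ (2 * a) * (n.descFactorial m : ℝ) * ((n - m).descFactorial 1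
      * heatSum c (fun k => g.monomial 0 k t) (fun k => h.monomial 0 k b) (n - m - 1))
      = c ^ (2 * a) * n.descFactorial (m + 1) * heatPoly c g h (n - (m + 1)) t b := by
    rw [← descFactorial_mul_cast, heatPoly_eq_heatSum, Nat.sub_sub]; ring
  rw [h3] at h2
  refine h2.trans_eq ?_
  rw [termBound, ← descFactorial_mul_cast, Nat.sub_sub]
  ring

theorem termPartial_eq_of_time_eq (hg0 : g 0 = 0) (a m n : ℕ) {s t : ℝ} (hs : 0 ≤ s) (ht : 0 ≤ t)
    (hst : g s = g t) (x : ℝ) :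
    termPartial α c g h a m n s x = termPartial α c g h a m n t x := by
  simp only [termPartial, heatPoly_eq_heatSum, monomial_eq_of_eq hg0 hs ht hst]

theorem termPartial_eq_of_space_eq (hh0 : h 0 = 0) (a m n : ℕ) {s t : ℝ} (hs : 0 ≤ s) (ht : 0 ≤ t)
    (hst : h s = h t) (x : ℝ) :
    termPartial α c g h a m n x s = termPartial α c g h a m n x t := by
  simp only [termPartial, heatPoly_eq_heatSum, monomial_eq_of_eq hh0 hs ht hst]

/-- Replaces an exchange of limit and derivative: the expansion, with remainder constants summable
over `n`, survives summation. -/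
theorem norm_tsum_taylor_le {E : Type*} [NormedAddCommGroup E] [NormedSpace ℝ E]
    {f₁ f₀ f' : ℕ → E} {K : ℕ → ℝ} {δ C e : ℝ} (h₁ : Summable f₁) (h₀ : Summable f₀)
    (h' : Summable f') (hK : Summable K) (H : ∀ n, ‖f₁ n - f₀ n - δ • f' n‖ ≤ K n * C * e) :
    ‖∑' n, f₁ n - ∑' n, f₀ n - δ • ∑' n, f' n‖ ≤ (∑' n, K n) * C * e := by
  have hs := (h₁.hasSum.sub h₀.hasSum).sub (h'.hasSum.const_smul δ)
  exact hs.norm_le_of_bounded ((hK.hasSum.mul_right C).mul_right e) H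

/-- The order of the differentiation in time. -/
def timeOrder : List Var → ℕ
  | [] => 0
  | .time :: w => timeOrder w + 1
  | .space :: w => timeOrder w

/-- The order of the differentiation, counted twice in time. -/
def parabolicOrder : List Var → ℕ
  | [] => 0
  | .time :: w => parabolicOrder w + 2
  | .space :: w => parabolicOrder w + 1

theorem hasIteratedPartial_of_family {E : Type*} [NormedAddCommGroup E] [NormedSpace ℝ E]
    {G : Derivator₂} {I J : Set ℝ} {u : ℝ → ℝ → E} {F : ℕ → ℕ → ℝ → ℝ → E}
    (h0 : ∀ t x, F 0 0 t x = u t x)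
    (htime : ∀ a m, HasPartial G I J .time (F a m) (F (a + 1) (m + 2)))
    (hspace : ∀ a m, HasPartial G I J .space (F a m) (F a (m + 1))) (w : List Var) :
    HasIteratedPartial G I J w u (F (timeOrder w) (parabolicOrder w)) := by
  induction w with
  | nil => exact fun t _ x _ => h0 t x
  | cons i w ih => cases i with
    | time => exact ⟨_, ih, htime _ _⟩
    | space => exact ⟨_, ih, hspace _ _⟩

theorem hasPartial_termPartial_time (hc : 0 < c) (hg0 : g 0 = 0) (hh0 : h 0 = 0)
    (hT : 0 < T) (hgT : T ∉ jumpSet g ∪ constSet g)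
    (hgT' : T ∉ constRightEnds g) (hg0' : 0 ∉ constLeftEnds g \ jumpSet g) (a m n : ℕ) :
    HasPartial (g.sum h) (Icc 0 T) (Icc 0 L) .time (termPartial α c g h a m n)
      (termPartial α c g h (a + 1) (m + 2) n) := fun _ ht x hx =>
  hasStieltjesDeriv_add_const g (h x) <| hasStieltjesDeriv_of_bound hT hgT hgT' hg0'
    (f' := fun t => termPartial α c g h (a + 1) (m + 2) n t x)
    (fun _ hs _ ht hst => termPartial_eq_of_time_eq hg0 _ _ n hs.1 ht.1 hst x)
    (fun _ hb _ hs hbs => norm_termPartial_taylor_time hc.le hh0 a m n hx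
      (abs_monomial_taylor_right hg0 hb hs hbs))
    (fun _ hb _ hs hsb => norm_termPartial_taylor_time hc.le hh0 a m n hx
      (abs_monomial_taylor_left hg0 hb hs hsb)) ht

theorem hasPartial_termPartial_space (hc : 0 < c) (hg0 : g 0 = 0) (hh0 : h 0 = 0)
    (hL : 0 < L) (hhL : L ∉ jumpSet h ∪ constSet h)
    (hhL' : L ∉ constRightEnds h) (hh0' : 0 ∉ constLeftEnds h \ jumpSet h) (a m n : ℕ) :
    HasPartial (g.sum h) (Icc 0 T) (Icc 0 L) .space (termPartial α c g h a m n)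
      (termPartial α c g h a (m + 1) n) := fun t ht x hx => by
  have := hasStieltjesDeriv_add_const h (g t) <| hasStieltjesDeriv_of_bound hL hhL hhL' hh0'
    (f' := fun x => termPartial α c g h a (m + 1) n t x)
    (fun _ hs _ ht hst => termPartial_eq_of_space_eq hh0 _ _ n hs.1 ht.1 hst t)
    (fun _ hb _ hs hbs => norm_termPartial_taylor_space hc.le hg0 a m n ht
      (abs_monomial_taylor_right hh0 hb hs hbs))
    (fun _ hb _ hs hsb => norm_termPartial_taylor_space hc.le hg0 a m n ht
      (abs_monomial_taylor_left hh0 hb hs hsb)) hx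
  simpa only [Derivator.sum, add_comm] using this

theorem summable_termBound_apply (hc : 0 < c) (hg0 : g 0 = 0) (hh0 : h 0 = 0)
    (hT : 0 < T) (hL : 0 < L)
    (hσ : ENNReal.ofReal (g T) < sigma α / ENNReal.ofReal (c ^ 2))
    (a m : ℕ) : Summable (termBound α c (g T) (h L) a m) :=
  summable_termBound hc (hg0 ▸ g.mono hT.le) (hh0 ▸ h.mono hL.le) hσ a m

theorem summable_norm_termPartial (hc : 0 < c) (hg0 : g 0 = 0) (hh0 : h 0 = 0)
    (hT : 0 < T) (hL : 0 < L)
    (hσ : ENNReal.ofReal (g T) < sigma α / ENNReal.ofReal (c ^ 2))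
    (a m : ℕ) {t x : ℝ} (ht : t ∈ Icc 0 T) (hx : x ∈ Icc 0 L) :
    Summable fun n => ‖termPartial α c g h a m n t x‖ :=
  (summable_termBound_apply hc hg0 hh0 hT hL hσ a m).of_nonneg_of_le (fun _ => norm_nonneg _)
    fun n => norm_termPartial_le hc.le hg0 hh0 a m n ht hx

theorem summable_termPartial (hc : 0 < c) (hg0 : g 0 = 0) (hh0 : h 0 = 0)
    (hT : 0 < T) (hL : 0 < L)
    (hσ : ENNReal.ofReal (g T) < sigma α / ENNReal.ofReal (c ^ 2))
    (a m : ℕ) {t x : ℝ} (ht : t ∈ Icc 0 T) (hx : x ∈ Icc 0 L) :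
    Summable fun n => termPartial α c g h a m n t x :=
  (summable_norm_termPartial hc hg0 hh0 hT hL hσ a m ht hx).of_norm

theorem hasPartial_seriesPartial_time (hc : 0 < c) (hg0 : g 0 = 0) (hh0 : h 0 = 0)
    (hT : 0 < T) (hL : 0 < L)
    (hσ : ENNReal.ofReal (g T) < sigma α / ENNReal.ofReal (c ^ 2))
    (hgT : T ∉ jumpSet g ∪ constSet g)
    (hgT' : T ∉ constRightEnds g) (hg0' : 0 ∉ constLeftEnds g \ jumpSet g) (a m : ℕ) :
    HasPartial (g.sum h) (Icc 0 T) (Icc 0 L) .time (seriesPartial α c g h a m)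
      (seriesPartial α c g h (a + 1) (m + 2)) := fun t ht x hx => by
  have hs := fun a m t (ht : t ∈ Icc 0 T) => summable_termPartial hc hg0 hh0 hT hL hσ a m ht hx
  have hK := summable_termBound_apply hc hg0 hh0 hT hL hσ (a + 2) (m + 4)
  refine hasStieltjesDeriv_add_const g (h x) <| hasStieltjesDeriv_of_bound hT hgT hgT' hg0'
    (f' := fun t => seriesPartial α c g h (a + 1) (m + 2) t x)
    (K := ∑' n, termBound α c (g T) (h L) (a + 2) (m + 4) n) ?_ ?_ ?_ ht
  · exact fun _ hs _ ht hst =>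
      tsum_congr fun n => termPartial_eq_of_time_eq hg0 _ _ n hs.1 ht.1 hst x
  · exact fun b hb r hr hbr => norm_tsum_taylor_le (hs _ _ _ hr) (hs _ _ _ hb) (hs _ _ _ hb) hK
      fun n => norm_termPartial_taylor_time hc.le hh0 a m n hx
        (abs_monomial_taylor_right hg0 hb hr hbr)
  · exact fun b hb r hr hrb => norm_tsum_taylor_le (hs _ _ _ hr) (hs _ _ _ hb) (hs _ _ _ hb) hK
      fun n => norm_termPartial_taylor_time hc.le hh0 a m n hx
        (abs_monomial_taylor_left hg0 hb hr hrb)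

theorem hasPartial_seriesPartial_space (hc : 0 < c) (hg0 : g 0 = 0) (hh0 : h 0 = 0)
    (hT : 0 < T) (hL : 0 < L)
    (hσ : ENNReal.ofReal (g T) < sigma α / ENNReal.ofReal (c ^ 2))
    (hhL : L ∉ jumpSet h ∪ constSet h)
    (hhL' : L ∉ constRightEnds h) (hh0' : 0 ∉ constLeftEnds h \ jumpSet h) (a m : ℕ) :
    HasPartial (g.sum h) (Icc 0 T) (Icc 0 L) .space (seriesPartial α c g h a m)
      (seriesPartial α c g h a (m + 1)) := fun t ht x hx => by
  have hs := fun a m x (hx : x ∈ Icc 0 L) => summable_termPartial hc hg0 hh0 hT hL hσ a m ht hx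
  have hK := summable_termBound_apply hc hg0 hh0 hT hL hσ a (m + 2)
  have : HasStieltjesDeriv h (Icc 0 L) (fun y => seriesPartial α c g h a m t y)
      (seriesPartial α c g h a (m + 1) t x) x := by
    refine hasStieltjesDeriv_of_bound hL hhL hhL' hh0'
      (f' := fun x => seriesPartial α c g h a (m + 1) t x)
      (K := ∑' n, termBound α c (g T) (h L) a (m + 2) n) ?_ ?_ ?_ hx
    · exact fun _ hs _ ht hst =>
        tsum_congr fun n => termPartial_eq_of_space_eq hh0 _ _ n hs.1 ht.1 hst t
    · exact fun b hb r hr hbr => norm_tsum_taylor_le (hs _ _ _ hr) (hs _ _ _ hb) (hs _ _ _ hb) hK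
        fun n => norm_termPartial_taylor_space hc.le hg0 a m n ht
          (abs_monomial_taylor_right hh0 hb hr hbr)
    · exact fun b hb r hr hrb => norm_tsum_taylor_le (hs _ _ _ hr) (hs _ _ _ hb) (hs _ _ _ hb) hK
        fun n => norm_termPartial_taylor_space hc.le hg0 a m n ht
          (abs_monomial_taylor_left hh0 hb hr hrb)
  simpa only [Derivator.sum, add_comm] using hasStieltjesDeriv_add_const h (g t) this

/-- At fixed weighted order `m`, trading two space derivatives for one in time only costs a factor
`c²`; this is the heat equation. -/
theorem seriesPartial_time_eq (a m : ℕ) (t x : ℝ) :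
    seriesPartial α c g h (a + 1) m t x = (c ^ 2) • seriesPartial α c g h a m t x := by
  rw [seriesPartial, seriesPartial, ← tsum_const_smul'']
  refine tsum_congr fun n => ?_
  rw [termPartial, termPartial, RCLike.real_smul_eq_coe_mul]
  push_cast
  ring

end Series

end StieltjesHeat

theorem mainTheorem11 {𝔽 : Type*} [RCLike 𝔽] (g h : Derivator) (T L c : ℝ)
    (hT : 0 < T) (hL : 0 < L) (hc : 0 < c)
    (hg0 : g 0 = 0) (hh0 : h 0 = 0)
    (hgT : T ∉ jumpSet g ∪ constSet g) (hhL : L ∉ jumpSet h ∪ constSet h)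
    -- the limits that define the derivatives on `[0, T]` and `[0, L]` make sense at the ends
    (hgT' : T ∉ constRightEnds g) (hhL' : L ∉ constRightEnds h)
    (hg0' : 0 ∉ constLeftEnds g \ jumpSet g) (hh0' : 0 ∉ constLeftEnds h \ jumpSet h)
    (α : ℕ → 𝔽)
    (hσ : ENNReal.ofReal (g T) < sigma α / ENNReal.ofReal (c ^ 2))
    (u : ℝ → ℝ → 𝔽)
    (hu : ∀ t x, u t x = ∑' n, α n * ((heatPoly c g h n t x : ℝ) : 𝔽)) :
    -- the series and all the series of its iterated derivatives converge absolutely and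
    -- uniformly, and their sums are `u` and its iterated derivatives
    (∀ w : List Var, ∃ (D : ℕ → ℝ → ℝ → 𝔽) (U : ℝ → ℝ → 𝔽),
      (∀ n, HasIteratedPartial (g.sum h) (Icc 0 T) (Icc 0 L) w
        (fun t x => α n * ((heatPoly c g h n t x : ℝ) : 𝔽)) (D n)) ∧
      HasIteratedPartial (g.sum h) (Icc 0 T) (Icc 0 L) w u U ∧
      (∀ t ∈ Icc 0 T, ∀ x ∈ Icc 0 L, Summable fun n => ‖D n t x‖) ∧
      TendstoUniformlyOn (fun (N : ℕ) (p : ℝ × ℝ) => ∑ n ∈ Finset.range N, D n p.1 p.2)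
        (fun p => U p.1 p.2) atTop (Icc 0 T ×ˢ Icc 0 L)) ∧
    IsHeatSolution (g.sum h) c (Icc 0 T) (Icc 0 L) u := by
  have hterm : ∀ n t x, termPartial α c g h 0 0 n t x
      = α n * ((heatPoly c g h n t x : ℝ) : 𝔽) := fun n t x => by simp [termPartial]
  have hit : ∀ w, HasIteratedPartial (g.sum h) (Icc 0 T) (Icc 0 L) w u
      (seriesPartial α c g h (timeOrder w) (parabolicOrder w)) :=
    hasIteratedPartial_of_family
      (fun t x => by rw [hu, seriesPartial]; exact tsum_congr fun n => hterm n t x)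
      (hasPartial_seriesPartial_time hc hg0 hh0 hT hL hσ hgT hgT' hg0')
      (hasPartial_seriesPartial_space hc hg0 hh0 hT hL hσ hhL hhL' hh0')
  refine ⟨fun w => ⟨termPartial α c g h (timeOrder w) (parabolicOrder w),
    seriesPartial α c g h (timeOrder w) (parabolicOrder w), fun n => ?_, hit w, ?_, ?_⟩,
    _, _, hit [.time], hit [.space, .space], fun t _ x _ => ?_⟩
  · exact hasIteratedPartial_of_family (F := fun a m => termPartial α c g h a m n) (hterm n)
      (fun a m => hasPartial_termPartial_time hc hg0 hh0 hT hgT hgT' hg0' a m n)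
      (fun a m => hasPartial_termPartial_space hc hg0 hh0 hL hhL hhL' hh0' a m n) w
  · exact fun t ht x hx => summable_norm_termPartial hc hg0 hh0 hT hL hσ _ _ ht hx
  · exact tendstoUniformlyOn_tsum_nat (summable_termBound_apply hc hg0 hh0 hT hL hσ _ _)
      fun n p hp => norm_termPartial_le hc.le hg0 hh0 _ _ n hp.1 hp.2
  · exact sub_eq_zero.2 (seriesPartial_time_eq 0 2 t x)
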